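/- \textbf{Types.} Types are given by $A ::= \alpha \mid A\multimap A \mid A\,\&\,A \mid \forall\alpha.A$, with $\alpha$ in a denumerable set of type variables, up to renaming of bound variables. $FV(A)$ is the set of free type variables of $A$, and $A$ is closed if $FV(A)=\emptyset$. Positive and negative subtypes of $A$ are defined by: $A$ is a positive subtype of itself; if $B\multimap C$ is a positive (resp. negative) subtype of $A$, then $C$ is a positive (resp. negative) and $B$ a negative (resp. positive) subtype; if $B\,\&\,C$ or $\forall\alpha.B$ is a positive (resp. negative) subtype, then so are $B$ and $C$, resp. $B$. A type is \emph{$\forall$-lazy} if none of its negative subtypes has the form $\forall\alpha.B$. A judgement $x_1:A_1,\dots,x_n:A_n\vdash M:B$ is $\forall$-lazy if the type $A_1\multimap\cdots\multimap A_n\multimap B$ is, and a \emph{$\forall$-lazy derivation} is a derivation of a $\forall$-lazy judgement. \textbf{Terms.} Raw terms, up to renaming of bound variables, are given by \[ M ::= x \mid \lambda x.M \mid MM \mid \langle M,M\rangle \mid \pi_1(M) \mid \pi_2(M) \mid \mathtt{copy}^{U} M\ \mathtt{as}\ x,y\ \mathtt{in}\ \langle M,M\rangle, \qquad U ::= x\mid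 \lambda x.U\mid UU\mid\langle U,U\rangle, \] where $\mathtt{copy}^{U} M\ \mathtt{as}\ x,y\ \mathtt{in}\ \langle P,Q\rangle$ binds $x$ in $P$ and $y$ in $Q$. A \emph{value} is a closed raw term of the grammar for $U$ that is normal for $(\lambda x.U)V\to U[V/x]$ (applied in any context); $\mathcal V$ is the set of values. Terms are the raw terms in which every superscript of $\mathtt{copy}$ is a value. Reduction $\to$ is the closure under all contexts of \[ (\lambda x.M)N\to M[N/x],\qquad \pi_i\langle M_1,M_2\rangle\to M_i,\qquad \mathtt{copy}^{V}U\ \mathtt{as}\ x_1,x_2\ \mathtt{in}\ \langle M_1,M_2\rangle\to\langle M_1[U/x_1],M_2[U/x_2]\rangle\quad(U,V\in\mathcal V). \] A term is normal if no reduction applies to it; a normal form of $M$ is a normal $N$ with $M\to^* N$. \textbf{The system $\mathsf{LAM}$.} Contexts $\Gamma,\Delta$ are finite multisets of assumptions $x:A$ with pairwise distinct term variables (so contexts that are joined declare different term variables), and $FV(\Gamma)$ is the set of free type variables of the types in $\Gamma$. The rules are: \begin{itemize} \item ($ax$) $x:A\vdash x:A$; \item ($cut$) from $\Gamma\vdash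 N:A$ and $\Delta,x:A\vdash M:C$ infer $\Gamma,\Delta\vdash M[N/x]:C$; \item ($\multimap$R) from $\Gamma,x:A\vdash M:B$ infer $\Gamma\vdash\lambda x.M:A\multimap B$; \item ($\multimap$L) from $\Gamma\vdash N:A$ and $\Delta,x:B\vdash M:C$ infer $\Gamma,y:A\multimap B,\Delta\vdash M[yN/x]:C$, provided that $FV(B)=\emptyset$ implies $FV(A)=\emptyset$; \item ($\forall$R) from $\Gamma\vdash M:A\langle\gamma/\alpha\rangle$ with $\gamma\notin FV(\Gamma)\cup FV(\forall\alpha.A)$ infer $\Gamma\vdash M:\forall\alpha.A$, provided that $FV(\forall\alpha.A)=\emptyset$ implies $FV(\Gamma)=\emptyset$; \item ($\forall$L) from $\Gamma,x:A\langle B/\alpha\rangle\vdash M:C$ infer $\Gamma,x:\forall\alpha.A\vdash M:C$; \item ($\&$R0) from $\vdash M_1:A_1$ and $\vdash M_2:A_2$ infer $\vdash\langle M_1,M_2\rangle:A_1\,\&\,A_2$; \item ($\&$L$i$, $i\in\{1,2\}$) from $\Gamma,x_i:A_i\vdash M:C$ infer $\Gamma,y:A_1\,\&\,A_2\vdash M[\pi_i(y)/x_i]:C$;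 \item ($\&$R1) from $x_1:A\vdash M_1:A_1$, $x_2:A\vdash M_2:A_2$ and $\vdash V:A$ infer $x:A\vdash\mathtt{copy}^{V}x\ \mathtt{as}\ x_1,x_2\ \mathtt{in}\ \langle M_1,M_2\rangle:A_1\,\&\,A_2$; \end{itemize} where in the last three rules $V\in\mathcal V$ and the types $A,A_1,A_2$ are closed and $\forall$-lazy. \textbf{Statement.} Let $\Gamma\vdash M:A$ have a $\forall$-lazy derivation in $\mathsf{LAM}$. Then $M$ has a unique normal form $M^\dagger$, and \begin{itemize} \item $M^\dagger$ is free from instances of $\mathtt{copy}$ and of the projections $\pi_1,\pi_2$; \item if $\Gamma=\emptyset$, then $M^\dagger\in\mathcal V$. \end{itemize} -/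

import Mathlib

namespace LAM

/-! ## Types -/

/-- Types `A ::= α | A ⊸ A | A & A | ∀α. A`, up to renaming of bound variables. De Bruijn indices are
used: type variables are natural numbers, and `all A` binds the index `0` of `A`; below `d`
quantifiers the index `n + d` denotes the (free) type variable `n`. -/
inductive Ty : Type
  | var : ℕ → Ty
  | lolli : Ty → Ty → Ty
  | with_ : Ty → Ty → Ty
  | all : Ty → Ty

/-- Push a renaming below a binder. -/
def liftRen (ρ : ℕ → ℕ) : ℕ → ℕ
  | 0 => 0
  | n + 1 => ρ n + 1

/-- Renaming of the free type variables. -/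
def Ty.rename : (ℕ → ℕ) → Ty → Ty
  | ρ, .var n => .var (ρ n)
  | ρ, .lolli A B => .lolli (A.rename ρ) (B.rename ρ)
  | ρ, .with_ A B => .with_ (A.rename ρ) (B.rename ρ)
  | ρ, .all A => .all (A.rename (liftRen ρ))

/-- Push a type substitution below a binder. -/
def Ty.liftSub (σ : ℕ → Ty) : ℕ → Ty
  | 0 => .var 0
  | n + 1 => (σ n).rename Nat.succ

/-- Capture-avoiding parallel substitution of types for the free type variables. -/
def Ty.subst : (ℕ → Ty) → Ty → Ty
  | σ, .var n => σ n
  | σ, .lolli A B => .lolli (A.subst σ) (B.subst σ)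
  | σ, .with_ A B => .with_ (A.subst σ) (B.subst σ)
  | σ, .all A => .all (A.subst (Ty.liftSub σ))

/-- The substitution that sends the index `0` to `B` and lowers all other indices. -/
def Ty.single (B : Ty) : ℕ → Ty
  | 0 => B
  | n + 1 => .var n

/-- `A⟨B/α⟩`, where `A` is the body of `∀α. A` (so that `α` is the index `0` of `A`). -/
def Ty.inst (A B : Ty) : Ty := A.subst (Ty.single B)

/-- The set of free type variables. -/
def Ty.FV : Ty → Set ℕ
  | .var n => {n}
  | .lolli A B => A.FV ∪ B.FV
  | .with_ A B => A.FV ∪ B.FV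
  | .all A => {n | n + 1 ∈ A.FV}

/-- A type is closed if it has no free type variables. -/
def Ty.Closed (A : Ty) : Prop := A.FV = ∅

/-- `IsSubtype A true B`: `B` is a positive subtype of `A`;
`IsSubtype A false B`: `B` is a negative subtype of `A`. -/
inductive IsSubtype (A : Ty) : Bool → Ty → Prop
  | refl : IsSubtype A true A
  | lolli_left {p : Bool} {B C : Ty} : IsSubtype A p (.lolli B C) → IsSubtype A (!p) B
  | lolli_right {p : Bool} {B C : Ty} : IsSubtype A p (.lolli B C) → IsSubtype A p C
  | with_left {p : Bool} {B C : Ty} : IsSubtype A p (.with_ B C) → IsSubtype A p B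
  | with_right {p : Bool} {B C : Ty} : IsSubtype A p (.with_ B C) → IsSubtype A p C
  | all {p : Bool} {B : Ty} : IsSubtype A p (.all B) → IsSubtype A p B

/-- A type is `∀`-lazy if it has no negative occurrence of `∀`. -/
def Ty.ForallLazy (A : Ty) : Prop := ¬ ∃ B : Ty, IsSubtype A false (.all B)

/-! ## Terms -/

/-- Raw terms, up to renaming of bound variables (De Bruijn indices): term variables are natural
numbers; `lam M` is `λx. M` and binds the index `0` of `M`; `proj i M` is the first projection for
`i = 0` and the second projection for `i = 1`; `copy V M P Q` is
`copy^V M as x₁, x₂ in ⟨P, Q⟩`, which binds the index `0` of `P` (that is `x₁`) and the index `0`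
of `Q` (that is `x₂`), and no variable of `V` and `M`. -/
inductive Tm : Type
  | var : ℕ → Tm
  | lam : Tm → Tm
  | app : Tm → Tm → Tm
  | pair : Tm → Tm → Tm
  | proj : Fin 2 → Tm → Tm
  | copy : Tm → Tm → Tm → Tm → Tm

/-- Renaming of the free variables. -/
def Tm.rename : (ℕ → ℕ) → Tm → Tm
  | ρ, .var n => .var (ρ n)
  | ρ, .lam M => .lam (M.rename (liftRen ρ))
  | ρ, .app M N => .app (M.rename ρ) (N.rename ρ)
  | ρ, .pair M N => .pair (M.rename ρ) (N.rename ρ)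
  | ρ, .proj i M => .proj i (M.rename ρ)
  | ρ, .copy V M P Q =>
      .copy (V.rename ρ) (M.rename ρ) (P.rename (liftRen ρ)) (Q.rename (liftRen ρ))

/-- Push a substitution below a binder. -/
def Tm.liftSub (σ : ℕ → Tm) : ℕ → Tm
  | 0 => .var 0
  | n + 1 => (σ n).rename Nat.succ

/-- Capture-avoiding parallel substitution of terms for the free variables. -/
def Tm.subst : (ℕ → Tm) → Tm → Tm
  | σ, .var n => σ n
  | σ, .lam M => .lam (M.subst (Tm.liftSub σ))
  | σ, .app M N => .app (M.subst σ) (N.subst σ)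
  | σ, .pair M N => .pair (M.subst σ) (N.subst σ)
  | σ, .proj i M => .proj i (M.subst σ)
  | σ, .copy V M P Q =>
      .copy (V.subst σ) (M.subst σ) (P.subst (Tm.liftSub σ)) (Q.subst (Tm.liftSub σ))

/-- The substitution that sends the index `0` to `N` and lowers all other indices. -/
def Tm.single (N : Tm) : ℕ → Tm
  | 0 => N
  | n + 1 => .var n

/-- `M[N/x]`, where `x` is the variable bound by a construct with body `M`
(so that `x` is the index `0` of `M`). -/
def Tm.inst (M N : Tm) : Tm := M.subst (Tm.single N)

/-- `M[N/x]` for a free variable `x` (no other variable changes its name). -/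
def Tm.substVar (M : Tm) (x : ℕ) (N : Tm) : Tm := M.subst (Function.update Tm.var x N)

/-- The set of free variables. -/
def Tm.FV : Tm → Set ℕ
  | .var n => {n}
  | .lam M => {n | n + 1 ∈ M.FV}
  | .app M N => M.FV ∪ N.FV
  | .pair M N => M.FV ∪ N.FV
  | .proj _ M => M.FV
  | .copy V M P Q => V.FV ∪ M.FV ∪ {n | n + 1 ∈ P.FV} ∪ {n | n + 1 ∈ Q.FV}

/-- `M` contains an instance of `copy`. -/
def Tm.HasCopy : Tm → Prop
  | .var _ => False
  | .lam M => M.HasCopy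
  | .app M N => M.HasCopy ∨ N.HasCopy
  | .pair M N => M.HasCopy ∨ N.HasCopy
  | .proj _ M => M.HasCopy
  | .copy _ _ _ _ => True

/-- `M` contains an instance of a projection. -/
def Tm.HasProj : Tm → Prop
  | .var _ => False
  | .lam M => M.HasProj
  | .app M N => M.HasProj ∨ N.HasProj
  | .pair M N => M.HasProj ∨ N.HasProj
  | .proj _ _ => True
  | .copy V M P Q => V.HasProj ∨ M.HasProj ∨ P.HasProj ∨ Q.HasProj

/-! ## Values and reduction -/

/-- The closure of a relation on terms under all one-hole contexts. -/
inductive Compat (R : Tm → Tm → Prop) : Tm → Tm → Prop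
  | root {M N : Tm} : R M N → Compat R M N
  | lam {M M' : Tm} : Compat R M M' → Compat R (.lam M) (.lam M')
  | app_left {M M' N : Tm} : Compat R M M' → Compat R (.app M N) (.app M' N)
  | app_right {M N N' : Tm} : Compat R N N' → Compat R (.app M N) (.app M N')
  | pair_left {M M' N : Tm} : Compat R M M' → Compat R (.pair M N) (.pair M' N)
  | pair_right {M N N' : Tm} : Compat R N N' → Compat R (.pair M N) (.pair M N')
  | proj {i : Fin 2} {M M' : Tm} : Compat R M M' → Compat R (.proj i M) (.proj i M')
  | copy_sup {V V' M P Q : Tm} : Compat R V V' → Compat R (.copy V M P Q) (.copy V' M P Q)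
  | copy_arg {V M M' P Q : Tm} : Compat R M M' → Compat R (.copy V M P Q) (.copy V M' P Q)
  | copy_left {V M P P' Q : Tm} : Compat R P P' → Compat R (.copy V M P Q) (.copy V M P' Q)
  | copy_right {V M P Q Q' : Tm} : Compat R Q Q' → Compat R (.copy V M P Q) (.copy V M P Q')

/-- The raw terms generated by the grammar `U ::= x | λx. U | U U | ⟨U, U⟩`. -/
inductive ValueGrammar : Tm → Prop
  | var (n : ℕ) : ValueGrammar (.var n)
  | lam {U : Tm} : ValueGrammar U → ValueGrammar (.lam U)
  | app {U V : Tm} : ValueGrammar U → ValueGrammar V → ValueGrammar (.app U V)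
  | pair {U V : Tm} : ValueGrammar U → ValueGrammar V → ValueGrammar (.pair U V)

/-- The root step `(λx. M) N → M[N/x]`. -/
inductive BetaRule : Tm → Tm → Prop
  | beta (M N : Tm) : BetaRule (.app (.lam M) N) (M.inst N)

/-- The set of values: closed terms of the grammar `ValueGrammar` that are normal with respect to
`(λx. U) V → U[V/x]`. -/
def Values : Set Tm :=
  {U | ValueGrammar U ∧ U.FV = ∅ ∧ ∀ N : Tm, ¬ Compat BetaRule U N}

/-- The root reduction steps. -/
inductive Rule : Tm → Tm → Prop
  | beta (M N : Tm) : Rule (.app (.lam M) N) (M.inst N)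
  | proj_fst (M₁ M₂ : Tm) : Rule (.proj 0 (.pair M₁ M₂)) M₁
  | proj_snd (M₁ M₂ : Tm) : Rule (.proj 1 (.pair M₁ M₂)) M₂
  | copy (V U M₁ M₂ : Tm) : V ∈ Values → U ∈ Values →
      Rule (.copy V U M₁ M₂) (.pair (M₁.inst U) (M₂.inst U))

/-- One-step reduction, in any context. -/
def Step : Tm → Tm → Prop := Compat Rule

/-- The reflexive and transitive closure of one-step reduction. -/
def Steps : Tm → Tm → Prop := Relation.ReflTransGen Step

/-- No reduction step applies to `M`. -/
def IsNormal (M : Tm) : Prop := ∀ N : Tm, ¬ Step M N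

/-- `N` is a normal form of `M`. -/
def IsNormalFormOf (N M : Tm) : Prop := Steps M N ∧ IsNormal N

/-! ## The type assignment system -/

/-- Contexts: finite multisets of assumptions `x : A`. -/
abbrev Ctx : Type := Multiset (ℕ × Ty)

/-- The set of term variables declared in a context. -/
def Ctx.dom (Γ : Ctx) : Set ℕ := {x | ∃ A : Ty, (x, A) ∈ Γ}

/-- The set of free type variables of a context. -/
def Ctx.FV (Γ : Ctx) : Set ℕ := {n | ∃ p ∈ Γ, n ∈ p.2.FV}

/-- The same context seen below a binder of a term variable: every variable is shifted, so that
the index `0` becomes fresh. -/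
def Ctx.shiftVar (Γ : Ctx) : Ctx := Γ.map (fun p => (p.1 + 1, p.2))

/-- The same context seen below a binder of a type variable: every free type variable is shifted,
so that the type variable `0` becomes fresh. -/
def Ctx.shiftTy (Γ : Ctx) : Ctx := Γ.map (fun p => (p.1, p.2.rename Nat.succ))

/-- Derivability `Γ ⊢ M : A` in the system `LAM`: the multiplicative and second-order rules with the
two closure conditions, together with the linear additive rules. Contexts that are put together
declare different term variables. -/
inductive Derives : Ctx → Tm → Ty → Prop
  | ax (x : ℕ) (A : Ty) : Derives {(x, A)} (.var x) A
  | cut {Γ Δ : Ctx} {x : ℕ} {N M : Tm} {A C : Ty} :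
      Derives Γ N A → Derives ((x, A) ::ₘ Δ) M C →
      x ∉ Δ.dom → Disjoint Γ.dom Δ.dom →
      Derives (Γ + Δ) (M.substVar x N) C
  | lolliR {Γ : Ctx} {M : Tm} {A B : Ty} :
      Derives ((0, A) ::ₘ Γ.shiftVar) M B →
      Derives Γ (.lam M) (.lolli A B)
  | lolliL {Γ Δ : Ctx} {x y : ℕ} {N M : Tm} {A B C : Ty} :
      Derives Γ N A → Derives ((x, B) ::ₘ Δ) M C →
      x ∉ Δ.dom → Disjoint Γ.dom Δ.dom → y ∉ Γ.dom → y ∉ Δ.dom →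
      -- first closure condition
      (B.FV = ∅ → A.FV = ∅) →
      Derives ((y, .lolli A B) ::ₘ (Γ + Δ)) (M.substVar x (.app (.var y) N)) C
  | allR {Γ : Ctx} {M : Tm} {A : Ty} :
      -- the bound type variable is the index `0`, which is fresh for `Γ.shiftTy`
      Derives Γ.shiftTy M A →
      -- second closure condition
      ((Ty.all A).FV = ∅ → Γ.FV = ∅) →
      Derives Γ M (.all A)
  | allL {Γ : Ctx} {x : ℕ} {M : Tm} {A B C : Ty} :
      Derives ((x, A.inst B) ::ₘ Γ) M C →
      Derives ((x, .all A) ::ₘ Γ) M C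
  | withR0 {M₁ M₂ : Tm} {A₁ A₂ : Ty} :
      Derives 0 M₁ A₁ → Derives 0 M₂ A₂ →
      A₁.Closed → A₁.ForallLazy → A₂.Closed → A₂.ForallLazy →
      Derives 0 (.pair M₁ M₂) (.with_ A₁ A₂)
  | withL1 {Γ : Ctx} {x y : ℕ} {M : Tm} {A₁ A₂ C : Ty} :
      Derives ((x, A₁) ::ₘ Γ) M C →
      x ∉ Γ.dom → y ∉ Γ.dom →
      A₁.Closed → A₁.ForallLazy → A₂.Closed → A₂.ForallLazy →
      Derives ((y, .with_ A₁ A₂) ::ₘ Γ) (M.substVar x (.proj 0 (.var y))) C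
  | withL2 {Γ : Ctx} {x y : ℕ} {M : Tm} {A₁ A₂ C : Ty} :
      Derives ((x, A₂) ::ₘ Γ) M C →
      x ∉ Γ.dom → y ∉ Γ.dom →
      A₁.Closed → A₁.ForallLazy → A₂.Closed → A₂.ForallLazy →
      Derives ((y, .with_ A₁ A₂) ::ₘ Γ) (M.substVar x (.proj 1 (.var y))) C
  | withR1 {x : ℕ} {M₁ M₂ V : Tm} {A A₁ A₂ : Ty} :
      Derives {(0, A)} M₁ A₁ → Derives {(0, A)} M₂ A₂ → Derives 0 V A →
      V ∈ Values →
      A.Closed → A.ForallLazy → A₁.Closed → A₁.ForallLazy → A₂.Closed → A₂.ForallLazy →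
      Derives {(x, A)} (.copy V (.var x) M₁ M₂) (.with_ A₁ A₂)

/-- The judgement `x₁ : A₁, …, xₙ : Aₙ ⊢ M : B` is `∀`-lazy if `A₁ ⊸ ⋯ ⊸ Aₙ ⊸ B` is a `∀`-lazy type
(the order of the assumptions is immaterial). -/
def ForallLazyJudgement (Γ : Ctx) (B : Ty) : Prop :=
  ∃ l : List (ℕ × Ty), (l : Multiset (ℕ × Ty)) = Γ ∧
    (l.foldr (fun p C => Ty.lolli p.2 C) B).ForallLazy

end LAM

namespace LAM

/-! ## Renaming and substitution -/

/-! The proof is a realizability argument on top of confluence. Reduction is confluent because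
parallel reduction has the diamond property, so uniqueness of normal forms is immediate and
membership in the interpretation of a type can be made invariant under conversion.

A type denotes a set of terms closed under conversion; no saturation condition is imposed, so ∀ is
an intersection over all such sets. The only unusual ingredient is a set of names attached to each
candidate. A neutral term belongs to a pair type when its free variables are names of that type.
Names come only from free type variables, hence a closed pair type contains only terms convertible
to actual pairs, and projections from it compute. An open pair type may still contain variables, as
a lazy judgement requires.

`Derives.adequate` puts every derivable term in its type under every valuation. `IsStandard.interp`
relates this to normalization when type variables denote sets between the neutral and the
normalizing terms over an infinite set `S` of variables: types without negative ∀ contain only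
normalizing terms, and types without positive ∀ contain all neutral terms. Since a closed type has
the same interpretation for every `S`, elements of a closed lazy type have normal forms whose
variables lie in every infinite `S`, so these are closed: they are values. This is what makes `copy`
fire in the adequacy proof, and it also yields the last clause of the theorem. -/

theorem liftRen_comp (ρ θ : ℕ → ℕ) : liftRen ρ ∘ liftRen θ = liftRen (ρ ∘ θ) := by
  funext n; cases n <;> rfl

theorem Tm.liftSub_comp_liftRen (σ : ℕ → Tm) (ρ : ℕ → ℕ) :
    Tm.liftSub σ ∘ liftRen ρ = Tm.liftSub (σ ∘ ρ) := by
  funext n; cases n <;> rfl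

theorem Tm.rename_rename (M : Tm) (ρ θ : ℕ → ℕ) :
    (M.rename θ).rename ρ = M.rename (ρ ∘ θ) := by
  induction M generalizing ρ θ <;> simp_all [Tm.rename, liftRen_comp]

theorem Tm.subst_rename (M : Tm) (σ : ℕ → Tm) (ρ : ℕ → ℕ) :
    (M.rename ρ).subst σ = M.subst (σ ∘ ρ) := by
  induction M generalizing ρ σ <;> simp_all [Tm.rename, Tm.subst, Tm.liftSub_comp_liftRen]

theorem Tm.rename_comp_liftSub (σ : ℕ → Tm) (ρ : ℕ → ℕ) :
    (fun n => (Tm.liftSub σ n).rename (liftRen ρ)) = Tm.liftSub (fun n => (σ n).rename ρ) := by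
  funext n
  cases n with
  | zero => rfl
  | succ n =>
    simp only [Tm.liftSub, Tm.rename_rename]
    rfl

theorem Tm.rename_subst (M : Tm) (σ : ℕ → Tm) (ρ : ℕ → ℕ) :
    (M.subst σ).rename ρ = M.subst (fun n => (σ n).rename ρ) := by
  induction M generalizing ρ σ <;> simp_all [Tm.rename, Tm.subst, Tm.rename_comp_liftSub]

theorem Tm.subst_comp_liftSub (σ τ : ℕ → Tm) :
    (fun n => (Tm.liftSub σ n).subst (Tm.liftSub τ)) = Tm.liftSub (fun n => (σ n).subst τ) := by
  funext n
  cases n with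
  | zero => rfl
  | succ n =>
    simp only [Tm.liftSub, Tm.subst_rename, Tm.rename_subst]
    rfl

theorem Tm.subst_subst (M : Tm) (σ τ : ℕ → Tm) :
    (M.subst σ).subst τ = M.subst (fun n => (σ n).subst τ) := by
  induction M generalizing σ τ <;> simp_all [Tm.subst, Tm.subst_comp_liftSub]

theorem Tm.subst_congr (M : Tm) {σ τ : ℕ → Tm} (h : ∀ n ∈ M.FV, σ n = τ n) :
    M.subst σ = M.subst τ := by
  have lift : ∀ {P : Tm} {σ τ : ℕ → Tm}, (∀ n, n + 1 ∈ P.FV → σ n = τ n) →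
      ∀ n ∈ P.FV, Tm.liftSub σ n = Tm.liftSub τ n := by
    intro P σ τ h n hn
    cases n with
    | zero => rfl
    | succ n => simp [Tm.liftSub, h n hn]
  induction M generalizing σ τ with
  | var n => exact h n rfl
  | lam M ih => exact congrArg Tm.lam (ih (lift fun n hn => h n hn))
  | app M N ihM ihN =>
    simp only [Tm.subst, ihM fun n hn => h n (Or.inl hn), ihN fun n hn => h n (Or.inr hn)]
  | pair M N ihM ihN =>
    simp only [Tm.subst, ihM fun n hn => h n (Or.inl hn), ihN fun n hn => h n (Or.inr hn)]
  | proj i M ih => exact congrArg (Tm.proj i) (ih h)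
  | copy V M P Q ihV ihM ihP ihQ =>
    simp only [Tm.subst, ihV fun n hn => h n (Or.inl (Or.inl (Or.inl hn))),
      ihM fun n hn => h n (Or.inl (Or.inl (Or.inr hn))),
      ihP (lift fun n hn => h n (Or.inl (Or.inr hn))), ihQ (lift fun n hn => h n (Or.inr hn))]

theorem Tm.liftSub_var_comp (ρ : ℕ → ℕ) :
    Tm.liftSub (fun n => Tm.var (ρ n)) = fun n => Tm.var (liftRen ρ n) := by
  funext n; cases n <;> rfl

theorem Tm.subst_var_comp (M : Tm) (ρ : ℕ → ℕ) : M.subst (fun n => Tm.var (ρ n)) = M.rename ρ := by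
  induction M generalizing ρ <;> simp_all [Tm.rename, Tm.subst, Tm.liftSub_var_comp]

theorem Tm.liftSub_var : Tm.liftSub Tm.var = Tm.var := by
  funext n; cases n <;> rfl

theorem Tm.subst_var (M : Tm) : M.subst Tm.var = M := by
  induction M <;> simp_all [Tm.subst, Tm.liftSub_var]

theorem Tm.subst_of_closed {M : Tm} (h : M.FV = ∅) (σ : ℕ → Tm) : M.subst σ = M :=
  (M.subst_congr fun n hn => by simp [h] at hn).trans M.subst_var

/-- The substitution that sends `0` to `N` and `n + 1` to `σ n`. -/
def Tm.cons (N : Tm) (σ : ℕ → Tm) : ℕ → Tm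
  | 0 => N
  | n + 1 => σ n

theorem Tm.inst_subst_liftSub (M N : Tm) (σ : ℕ → Tm) :
    (M.subst (Tm.liftSub σ)).inst N = M.subst (Tm.cons N σ) := by
  rw [Tm.inst, Tm.subst_subst]
  congr 1
  funext n
  cases n with
  | zero => rfl
  | succ n =>
    simp only [Tm.liftSub, Tm.subst_rename]
    exact (σ n).subst_var

theorem Tm.subst_inst (M N : Tm) (σ : ℕ → Tm) :
    (M.inst N).subst σ = (M.subst (Tm.liftSub σ)).inst (N.subst σ) := by
  rw [Tm.inst_subst_liftSub, Tm.inst, Tm.subst_subst]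
  congr 1
  funext n
  cases n <;> rfl

/-- Turns the term substitution in the left rules and in cut into an update of the realizing
substitution, the form that the adequacy induction needs. -/
theorem Tm.substVar_subst (M N : Tm) (x : ℕ) (σ : ℕ → Tm) :
    (M.substVar x N).subst σ = M.subst (Function.update σ x (N.subst σ)) := by
  rw [Tm.substVar, Tm.subst_subst]
  congr 1
  funext n
  by_cases h : n = x
  · subst h; simp
  · simp [h, Tm.subst]

/-! ## Free variables -/

theorem Tm.FV_finite (M : Tm) : M.FV.Finite := by
  have pre : ∀ {s : Set ℕ}, s.Finite → {n | n + 1 ∈ s}.Finite := fun h =>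
    h.preimage (Function.Injective.injOn fun _ _ => Nat.succ.inj)
  induction M with
  | var n => exact Set.finite_singleton n
  | lam M ih => exact pre ih
  | app M N ihM ihN => exact ihM.union ihN
  | pair M N ihM ihN => exact ihM.union ihN
  | proj i M ih => exact ih
  | copy V M P Q ihV ihM ihP ihQ => exact ((ihV.union ihM).union (pre ihP)).union (pre ihQ)

theorem Tm.exists_of_mem_FV_rename {M : Tm} {ρ : ℕ → ℕ} {n : ℕ} (h : n ∈ (M.rename ρ).FV) :
    ∃ m ∈ M.FV, ρ m = n := by
  have lift : ∀ {P : Tm} {ρ : ℕ → ℕ} {n : ℕ}, (∃ m ∈ P.FV, liftRen ρ m = n + 1) →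
      ∃ m, m + 1 ∈ P.FV ∧ ρ m = n := by
    rintro P ρ n ⟨_ | m, hm, e⟩
    · simp [liftRen] at e
    · exact ⟨m, hm, by simpa [liftRen] using e⟩
  induction M generalizing ρ n with
  | var m => exact ⟨m, rfl, h.symm⟩
  | lam M ih => exact lift (ih h)
  | app M N ihM ihN =>
    rcases h with h | h
    · obtain ⟨m, hm, e⟩ := ihM h; exact ⟨m, Or.inl hm, e⟩
    · obtain ⟨m, hm, e⟩ := ihN h; exact ⟨m, Or.inr hm, e⟩
  | pair M N ihM ihN =>
    rcases h with h | h
    · obtain ⟨m, hm, e⟩ := ihM h; exact ⟨m, Or.inl hm, e⟩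
    · obtain ⟨m, hm, e⟩ := ihN h; exact ⟨m, Or.inr hm, e⟩
  | proj i M ih => exact ih h
  | copy V M P Q ihV ihM ihP ihQ =>
    rcases h with ((h | h) | h) | h
    · obtain ⟨m, hm, e⟩ := ihV h; exact ⟨m, Or.inl (Or.inl (Or.inl hm)), e⟩
    · obtain ⟨m, hm, e⟩ := ihM h; exact ⟨m, Or.inl (Or.inl (Or.inr hm)), e⟩
    · obtain ⟨m, hm, e⟩ := lift (ihP h); exact ⟨m, Or.inl (Or.inr hm), e⟩
    · obtain ⟨m, hm, e⟩ := lift (ihQ h); exact ⟨m, Or.inr hm, e⟩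

theorem Tm.exists_of_mem_FV_subst {M : Tm} {σ : ℕ → Tm} {n : ℕ} (h : n ∈ (M.subst σ).FV) :
    ∃ m ∈ M.FV, n ∈ (σ m).FV := by
  have lift : ∀ {P : Tm} {σ : ℕ → Tm} {n : ℕ}, (∃ m ∈ P.FV, n + 1 ∈ (Tm.liftSub σ m).FV) →
      ∃ m, m + 1 ∈ P.FV ∧ n ∈ (σ m).FV := by
    rintro P σ n ⟨_ | m, hm, e⟩
    · simp [Tm.liftSub, Tm.FV] at e
    · obtain ⟨k, hk, e⟩ := Tm.exists_of_mem_FV_rename e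
      obtain rfl : k = n := Nat.succ.inj e
      exact ⟨m, hm, hk⟩
  induction M generalizing σ n with
  | var m => exact ⟨m, rfl, h⟩
  | lam M ih => exact lift (ih h)
  | app M N ihM ihN =>
    rcases h with h | h
    · obtain ⟨m, hm, e⟩ := ihM h; exact ⟨m, Or.inl hm, e⟩
    · obtain ⟨m, hm, e⟩ := ihN h; exact ⟨m, Or.inr hm, e⟩
  | pair M N ihM ihN =>
    rcases h with h | h
    · obtain ⟨m, hm, e⟩ := ihM h; exact ⟨m, Or.inl hm, e⟩
    · obtain ⟨m, hm, e⟩ := ihN h; exact ⟨m, Or.inr hm, e⟩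
  | proj i M ih => exact ih h
  | copy V M P Q ihV ihM ihP ihQ =>
    rcases h with ((h | h) | h) | h
    · obtain ⟨m, hm, e⟩ := ihV h; exact ⟨m, Or.inl (Or.inl (Or.inl hm)), e⟩
    · obtain ⟨m, hm, e⟩ := ihM h; exact ⟨m, Or.inl (Or.inl (Or.inr hm)), e⟩
    · obtain ⟨m, hm, e⟩ := lift (ihP h); exact ⟨m, Or.inl (Or.inr hm), e⟩
    · obtain ⟨m, hm, e⟩ := lift (ihQ h); exact ⟨m, Or.inr hm, e⟩

theorem Tm.FV_inst_subset {M N : Tm} {n : ℕ} (h : n ∈ (M.inst N).FV) :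
    n + 1 ∈ M.FV ∨ n ∈ N.FV := by
  obtain ⟨_ | m, hm, e⟩ := Tm.exists_of_mem_FV_subst h
  · exact Or.inr e
  · obtain rfl : n = m := e
    exact Or.inl hm

theorem Step.FV_subset {M N : Tm} (h : Step M N) : N.FV ⊆ M.FV := by
  induction h with
  | root h =>
    cases h with
    | beta M N => exact fun n hn => Tm.FV_inst_subset hn
    | proj_fst M N => exact fun n hn => Or.inl hn
    | proj_snd M N => exact fun n hn => Or.inr hn
    | copy V U P Q hV hU =>
      rintro n (hn | hn)
      · exact (Tm.FV_inst_subset hn).elim (fun h => Or.inl (Or.inr h))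
          fun h => Or.inl (Or.inl (Or.inr h))
      · exact (Tm.FV_inst_subset hn).elim Or.inr fun h => Or.inl (Or.inl (Or.inr h))
  | lam _ ih => exact fun n hn => ih hn
  | app_left _ ih => exact Set.union_subset_union_left _ ih
  | app_right _ ih => exact Set.union_subset_union_right _ ih
  | pair_left _ ih => exact Set.union_subset_union_left _ ih
  | pair_right _ ih => exact Set.union_subset_union_right _ ih
  | proj _ ih => exact ih
  | copy_sup _ ih =>
    rintro n (((h | h) | h) | h)
    exacts [Or.inl (Or.inl (Or.inl (ih h))), Or.inl (Or.inl (Or.inr h)), Or.inl (Or.inr h),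
      Or.inr h]
  | copy_arg _ ih =>
    rintro n (((h | h) | h) | h)
    exacts [Or.inl (Or.inl (Or.inl h)), Or.inl (Or.inl (Or.inr (ih h))), Or.inl (Or.inr h),
      Or.inr h]
  | copy_left _ ih =>
    rintro n (((h | h) | h) | h)
    exacts [Or.inl (Or.inl (Or.inl h)), Or.inl (Or.inl (Or.inr h)), Or.inl (Or.inr (ih h)),
      Or.inr h]
  | copy_right _ ih =>
    rintro n (((h | h) | h) | h)
    exacts [Or.inl (Or.inl (Or.inl h)), Or.inl (Or.inl (Or.inr h)), Or.inl (Or.inr h),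
      Or.inr (ih h)]

theorem Steps.FV_subset {M N : Tm} (h : Steps M N) : N.FV ⊆ M.FV := by
  induction h with
  | refl => exact subset_rfl
  | tail _ h ih => exact h.FV_subset.trans ih

/-! ## Congruence of many-step reduction -/

theorem Steps.map (f : Tm → Tm) (hf : ∀ {M N : Tm}, Step M N → Step (f M) (f N)) {M N : Tm}
    (h : Steps M N) : Steps (f M) (f N) := by
  induction h with
  | refl => exact .refl
  | tail _ h ih => exact ih.tail (hf h)

theorem Steps.lam {M M' : Tm} (h : Steps M M') : Steps (.lam M) (.lam M') :=
  Steps.map Tm.lam Compat.lam h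

theorem Steps.app {M M' N N' : Tm} (hM : Steps M M') (hN : Steps N N') :
    Steps (.app M N) (.app M' N') :=
  (Steps.map (fun M => Tm.app M N) Compat.app_left hM).trans
    (Steps.map (fun N => Tm.app M' N) Compat.app_right hN)

theorem Steps.pair {M M' N N' : Tm} (hM : Steps M M') (hN : Steps N N') :
    Steps (.pair M N) (.pair M' N') :=
  (Steps.map (fun M => Tm.pair M N) Compat.pair_left hM).trans
    (Steps.map (fun N => Tm.pair M' N) Compat.pair_right hN)

theorem Steps.proj {i : Fin 2} {M M' : Tm} (h : Steps M M') : Steps (.proj i M) (.proj i M') :=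
  Steps.map (Tm.proj i) Compat.proj h

theorem Steps.copy {V V' M M' P P' Q Q' : Tm} (hV : Steps V V') (hM : Steps M M')
    (hP : Steps P P') (hQ : Steps Q Q') : Steps (.copy V M P Q) (.copy V' M' P' Q') :=
  (((Steps.map (fun V => Tm.copy V M P Q) Compat.copy_sup hV).trans
    (Steps.map (fun M => Tm.copy V' M P Q) Compat.copy_arg hM)).trans
    (Steps.map (fun P => Tm.copy V' M' P Q) Compat.copy_left hP)).trans
    (Steps.map (fun Q => Tm.copy V' M' P' Q) Compat.copy_right hQ)

/-! ## Parallel reduction and confluence -/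

/-- Parallel reduction. -/
inductive Par : Tm → Tm → Prop
  | var (n : ℕ) : Par (.var n) (.var n)
  | lam {M M' : Tm} : Par M M' → Par (.lam M) (.lam M')
  | app {M M' N N' : Tm} : Par M M' → Par N N' → Par (.app M N) (.app M' N')
  | pair {M M' N N' : Tm} : Par M M' → Par N N' → Par (.pair M N) (.pair M' N')
  | proj {i : Fin 2} {M M' : Tm} : Par M M' → Par (.proj i M) (.proj i M')
  | copy {V V' M M' P P' Q Q' : Tm} : Par V V' → Par M M' → Par P P' → Par Q Q' →
      Par (.copy V M P Q) (.copy V' M' P' Q')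
  | beta {M M' N N' : Tm} : Par M M' → Par N N' → Par (.app (.lam M) N) (M'.inst N')
  | fst {M M' N : Tm} : Par M M' → Par (.proj 0 (.pair M N)) M'
  | snd {M N N' : Tm} : Par N N' → Par (.proj 1 (.pair M N)) N'
  | dup {V U P P' Q Q' : Tm} : V ∈ Values → U ∈ Values → Par P P' → Par Q Q' →
      Par (.copy V U P Q) (.pair (P'.inst U) (Q'.inst U))

theorem Par.refl (M : Tm) : Par M M := by
  induction M with
  | var n => exact .var n
  | lam M ih => exact .lam ih
  | app M N ihM ihN => exact .app ihM ihN
  | pair M N ihM ihN => exact .pair ihM ihN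
  | proj i M ih => exact .proj ih
  | copy V M P Q ihV ihM ihP ihQ => exact .copy ihV ihM ihP ihQ

theorem Step.par {M N : Tm} (h : Step M N) : Par M N := by
  induction h with
  | root h =>
    cases h with
    | beta M N => exact .beta (.refl M) (.refl N)
    | proj_fst M N => exact .fst (.refl _)
    | proj_snd M N => exact .snd (.refl _)
    | copy V U P Q hV hU => exact .dup hV hU (.refl P) (.refl Q)
  | lam _ ih => exact .lam ih
  | app_left _ ih => exact .app ih (.refl _)
  | app_right _ ih => exact .app (.refl _) ih
  | pair_left _ ih => exact .pair ih (.refl _)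
  | pair_right _ ih => exact .pair (.refl _) ih
  | proj _ ih => exact .proj ih
  | copy_sup _ ih => exact .copy ih (.refl _) (.refl _) (.refl _)
  | copy_arg _ ih => exact .copy (.refl _) ih (.refl _) (.refl _)
  | copy_left _ ih => exact .copy (.refl _) (.refl _) ih (.refl _)
  | copy_right _ ih => exact .copy (.refl _) (.refl _) (.refl _) ih

theorem Par.steps {M N : Tm} (h : Par M N) : Steps M N := by
  induction h with
  | var n => exact .refl
  | lam _ ih => exact ih.lam
  | app _ _ ihM ihN => exact Steps.app ihM ihN
  | pair _ _ ihM ihN => exact Steps.pair ihM ihN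
  | proj _ ih => exact ih.proj
  | copy _ _ _ _ ihV ihM ihP ihQ => exact Steps.copy ihV ihM ihP ihQ
  | beta _ _ ihM ihN => exact (Steps.app ihM.lam ihN).tail (.root (.beta _ _))
  | fst _ ih => exact (Steps.proj (ih.pair .refl)).tail (.root (.proj_fst _ _))
  | snd _ ih => exact (Steps.proj (Steps.pair .refl ih)).tail (.root (.proj_snd _ _))
  | dup hV hU _ _ ihP ihQ =>
    exact (Steps.copy .refl .refl ihP ihQ).tail (.root (.copy _ _ _ _ hV hU))

theorem Tm.rename_of_closed {M : Tm} (h : M.FV = ∅) (ρ : ℕ → ℕ) : M.rename ρ = M :=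
  (M.subst_var_comp ρ).symm.trans (Tm.subst_of_closed h _)

theorem Tm.rename_inst (M N : Tm) (ρ : ℕ → ℕ) :
    (M.inst N).rename ρ = (M.rename (liftRen ρ)).inst (N.rename ρ) := by
  rw [← Tm.subst_var_comp, ← Tm.subst_var_comp, ← Tm.subst_var_comp, ← Tm.liftSub_var_comp,
    Tm.subst_inst]

theorem Par.rename {M M' : Tm} (h : Par M M') (ρ : ℕ → ℕ) : Par (M.rename ρ) (M'.rename ρ) := by
  induction h generalizing ρ with
  | var n => exact .var _
  | lam _ ih => exact .lam (ih _)
  | app _ _ ihM ihN => exact .app (ihM _) (ihN _)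
  | pair _ _ ihM ihN => exact .pair (ihM _) (ihN _)
  | proj _ ih => exact .proj (ih _)
  | copy _ _ _ _ ihV ihM ihP ihQ => exact .copy (ihV _) (ihM _) (ihP _) (ihQ _)
  | beta _ _ ihM ihN => rw [Tm.rename_inst]; exact .beta (ihM _) (ihN _)
  | fst _ ih => exact .fst (ih _)
  | snd _ ih => exact .snd (ih _)
  | dup hV hU _ _ ihP ihQ =>
    -- Values are closed, so renaming leaves the superscript and the copied value unchanged and the
    -- side conditions survive.
    simp only [Tm.rename, Tm.rename_inst, Tm.rename_of_closed hV.2.1, Tm.rename_of_closed hU.2.1]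
    exact .dup hV hU (ihP _) (ihQ _)

theorem Par.liftSub {σ τ : ℕ → Tm} (h : ∀ n, Par (σ n) (τ n)) (n : ℕ) :
    Par (Tm.liftSub σ n) (Tm.liftSub τ n) := by
  cases n with
  | zero => exact .var 0
  | succ n => exact (h n).rename _

theorem Par.subst {M M' : Tm} (h : Par M M') {σ τ : ℕ → Tm} (hσ : ∀ n, Par (σ n) (τ n)) :
    Par (M.subst σ) (M'.subst τ) := by
  induction h generalizing σ τ with
  | var n => exact hσ n
  | lam _ ih => exact .lam (ih (Par.liftSub hσ))
  | app _ _ ihM ihN => exact .app (ihM hσ) (ihN hσ)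
  | pair _ _ ihM ihN => exact .pair (ihM hσ) (ihN hσ)
  | proj _ ih => exact .proj (ih hσ)
  | copy _ _ _ _ ihV ihM ihP ihQ =>
    exact .copy (ihV hσ) (ihM hσ) (ihP (Par.liftSub hσ)) (ihQ (Par.liftSub hσ))
  | beta _ _ ihM ihN =>
    rw [Tm.subst_inst]
    exact .beta (ihM (Par.liftSub hσ)) (ihN hσ)
  | fst _ ih => exact .fst (ih hσ)
  | snd _ ih => exact .snd (ih hσ)
  | dup hV hU _ _ ihP ihQ =>
    simp only [Tm.subst, Tm.subst_inst, Tm.subst_of_closed hV.2.1, Tm.subst_of_closed hU.2.1]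
    exact .dup hV hU (ihP (Par.liftSub hσ)) (ihQ (Par.liftSub hσ))

theorem Par.inst {M M' N N' : Tm} (hM : Par M M') (hN : Par N N') :
    Par (M.inst N) (M'.inst N') := by
  refine hM.subst fun n => ?_
  cases n with
  | zero => exact hN
  | succ n => exact .var n

/-- In this grammar only β could fire, and β-normality forbids it. Hence a `copy` redex cannot be
destroyed by reducing its superscript or its argument. -/
theorem ValueGrammar.eq_of_par {U U' : Tm} (hU : ValueGrammar U)
    (hn : ∀ N, ¬ Compat BetaRule U N) (h : Par U U') : U' = U := by
  induction hU generalizing U' with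
  | var n => cases h; rfl
  | lam _ ih =>
    cases h with
    | lam h => rw [ih (fun N hN => hn _ (.lam hN)) h]
  | app _ _ ihM ihN =>
    cases h with
    | app hM hN =>
      rw [ihM (fun N hN => hn _ (.app_left hN)) hM, ihN (fun N hN => hn _ (.app_right hN)) hN]
    | beta => exact (hn _ (.root (.beta _ _))).elim
  | pair _ _ ihM ihN =>
    cases h with
    | pair hM hN =>
      rw [ihM (fun N hN => hn _ (.pair_left hN)) hM, ihN (fun N hN => hn _ (.pair_right hN)) hN]

theorem Par.eq_of_mem_values {U U' : Tm} (h : Par U U') (hU : U ∈ Values) : U' = U :=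
  hU.1.eq_of_par hU.2.2 h

/-- The overlaps are a root step against a step inside the redex. For β and projections the inner
step preserves the outer constructor; for `copy` the two values are rigid, so only the two branches
can move. -/
theorem Par.diamond {M N N' : Tm} (h : Par M N) (h' : Par M N') : ∃ R, Par N R ∧ Par N' R := by
  induction h generalizing N' with
  | var n => cases h'; exact ⟨_, .var n, .var n⟩
  | lam _ ih =>
    cases h' with
    | lam h' => obtain ⟨R, h₁, h₂⟩ := ih h'; exact ⟨_, .lam h₁, .lam h₂⟩
  | app h₁ h₂ ih₁ ih₂ =>
    cases h' with
    | app h₁' h₂' =>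
      obtain ⟨R, a, b⟩ := ih₁ h₁'
      obtain ⟨S, c, d⟩ := ih₂ h₂'
      exact ⟨_, .app a c, .app b d⟩
    | beta h₁' h₂' =>
      -- The induction hypothesis speaks of the whole abstraction; inverting the three `lam` steps
      -- recovers the join of the bodies.
      obtain ⟨R, a, b⟩ := ih₁ (.lam h₁')
      obtain ⟨S, c, d⟩ := ih₂ h₂'
      cases h₁ with
      | lam h₁ =>
        cases b with
        | lam b =>
          cases a with
          | lam a => exact ⟨_, .beta a c, b.inst d⟩
  | pair h₁ h₂ ih₁ ih₂ =>
    cases h' with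
    | pair h₁' h₂' =>
      obtain ⟨R, a, b⟩ := ih₁ h₁'
      obtain ⟨S, c, d⟩ := ih₂ h₂'
      exact ⟨_, .pair a c, .pair b d⟩
  | proj h ih =>
    cases h' with
    | proj h' => obtain ⟨R, a, b⟩ := ih h'; exact ⟨_, .proj a, .proj b⟩
    | fst h' =>
      obtain ⟨R, a, b⟩ := ih (.pair h' (.refl _))
      cases h with
      | pair =>
        cases b with
        | pair b =>
          cases a with
          | pair a => exact ⟨_, .fst a, b⟩
    | snd h' =>
      obtain ⟨R, a, b⟩ := ih (.pair (.refl _) h')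
      cases h with
      | pair =>
        cases b with
        | pair _ b =>
          cases a with
          | pair _ a => exact ⟨_, .snd a, b⟩
  | copy hV hM hP hQ ihV ihM ihP ihQ =>
    cases h' with
    | copy hV' hM' hP' hQ' =>
      obtain ⟨_, a, b⟩ := ihV hV'
      obtain ⟨_, c, d⟩ := ihM hM'
      obtain ⟨_, e, f⟩ := ihP hP'
      obtain ⟨_, g, i⟩ := ihQ hQ'
      exact ⟨_, .copy a c e g, .copy b d f i⟩
    | dup vV vU hP' hQ' =>
      obtain ⟨_, e, f⟩ := ihP hP'
      obtain ⟨_, g, i⟩ := ihQ hQ'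
      rw [hV.eq_of_mem_values vV, hM.eq_of_mem_values vU]
      exact ⟨_, .dup vV vU e g, .pair (f.inst (.refl _)) (i.inst (.refl _))⟩
  | beta h₁ h₂ ih₁ ih₂ =>
    cases h' with
    | app h₁' h₂' =>
      obtain ⟨S, c, d⟩ := ih₂ h₂'
      cases h₁' with
      | lam h₁' =>
        obtain ⟨R, a, b⟩ := ih₁ h₁'
        exact ⟨_, a.inst c, .beta b d⟩
    | beta h₁' h₂' =>
      obtain ⟨R, a, b⟩ := ih₁ h₁'
      obtain ⟨S, c, d⟩ := ih₂ h₂'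
      exact ⟨_, a.inst c, b.inst d⟩
  | fst _ ih =>
    cases h' with
    | proj h' =>
      cases h' with
      | pair h' => obtain ⟨R, a, b⟩ := ih h'; exact ⟨_, a, .fst b⟩
    | fst h' => exact ih h'
  | snd _ ih =>
    cases h' with
    | proj h' =>
      cases h' with
      | pair _ h' => obtain ⟨R, a, b⟩ := ih h'; exact ⟨_, a, .snd b⟩
    | snd h' => exact ih h'
  | dup vV vU hP hQ ihP ihQ =>
    cases h' with
    | copy hV' hM' hP' hQ' =>
      obtain ⟨_, e, f⟩ := ihP hP'
      obtain ⟨_, g, i⟩ := ihQ hQ'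
      rw [hV'.eq_of_mem_values vV, hM'.eq_of_mem_values vU]
      exact ⟨_, .pair (e.inst (.refl _)) (g.inst (.refl _)), .dup vV vU f i⟩
    | dup _ _ hP' hQ' =>
      obtain ⟨_, e, f⟩ := ihP hP'
      obtain ⟨_, g, i⟩ := ihQ hQ'
      exact ⟨_, .pair (e.inst (.refl _)) (g.inst (.refl _)),
        .pair (f.inst (.refl _)) (i.inst (.refl _))⟩

/-! ### Confluence and convertibility -/

theorem steps_eq_reflTransGen_par : Steps = Relation.ReflTransGen Par := by
  funext M N
  refine propext ⟨fun h => ?_, fun h => ?_⟩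
  · induction h with
    | refl => exact .refl
    | tail _ h ih => exact ih.tail h.par
  · induction h with
    | refl => exact .refl
    | tail _ h ih => exact ih.trans h.steps

/-- Two terms are convertible if they have a common reduct. -/
def Conv (M N : Tm) : Prop := Relation.Join Steps M N

theorem Steps.conv {M N : Tm} (h : Steps M N) : Conv M N := ⟨N, h, .refl⟩

theorem Conv.symm {M N : Tm} (h : Conv M N) : Conv N M := by
  obtain ⟨R, a, b⟩ := h
  exact ⟨R, b, a⟩

theorem Conv.trans {M N P : Tm} (h : Conv M N) (h' : Conv N P) : Conv M P := by
  have e : Equivalence (Relation.Join Steps) := by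
    rw [steps_eq_reflTransGen_par]
    refine Relation.equivalence_join_reflTransGen fun a b c hb hc => ?_
    obtain ⟨d, h₁, h₂⟩ := hb.diamond hc
    exact ⟨d, .single h₁, .single h₂⟩
  exact e.trans h h'

theorem Conv.app {M M' N N' : Tm} (h : Conv M M') (h' : Conv N N') :
    Conv (.app M N) (.app M' N') := by
  obtain ⟨R, a, b⟩ := h
  obtain ⟨S, c, d⟩ := h'
  exact ⟨_, a.app c, b.app d⟩

theorem Conv.pair {M M' N N' : Tm} (h : Conv M M') (h' : Conv N N') :
    Conv (.pair M N) (.pair M' N') := by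
  obtain ⟨R, a, b⟩ := h
  obtain ⟨S, c, d⟩ := h'
  exact ⟨_, a.pair c, b.pair d⟩

theorem IsNormal.eq_of_steps {M N : Tm} (hM : IsNormal M) (h : Steps M N) : M = N := by
  cases h.cases_head with
  | inl h => exact h
  | inr h => exact (hM _ h.choose_spec.1).elim

theorem Conv.steps {M N : Tm} (h : Conv M N) (hN : IsNormal N) : Steps M N := by
  obtain ⟨R, a, b⟩ := h
  rwa [hN.eq_of_steps b]

/-! ## Normal forms without `copy` and projections -/

/-- `Nf true`: neutral terms `x U₁ ⋯ Uₙ`; `Nf false`: terms built from neutral terms by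
abstraction and pairing. -/
inductive Nf : Bool → Tm → Prop
  | var (n : ℕ) : Nf true (.var n)
  | app {M N : Tm} : Nf true M → Nf false N → Nf true (.app M N)
  | ofNeutral {M : Tm} : Nf true M → Nf false M
  | lam {M : Tm} : Nf false M → Nf false (.lam M)
  | pair {M N : Tm} : Nf false M → Nf false N → Nf false (.pair M N)

theorem Nf.not_lam {M : Tm} : ¬ Nf true (.lam M) := nofun

theorem Nf.isNormal {b : Bool} {M : Tm} (h : Nf b M) : IsNormal M := by
  induction h with
  | var n =>
    rintro N (h | _)
    cases h
  | app hM _ ihM ihN =>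
    intro N h
    cases h with
    | root h =>
      cases h with
      | beta => exact Nf.not_lam hM
    | app_left h => exact ihM _ h
    | app_right h => exact ihN _ h
  | ofNeutral _ ih => exact ih
  | lam _ ih =>
    intro N h
    cases h with
    | root h => cases h
    | lam h => exact ih _ h
  | pair _ _ ihM ihN =>
    intro N h
    cases h with
    | root h => cases h
    | pair_left h => exact ihM _ h
    | pair_right h => exact ihN _ h

theorem Nf.rename {b : Bool} {M : Tm} (h : Nf b M) (ρ : ℕ → ℕ) : Nf b (M.rename ρ) := by
  induction h generalizing ρ with
  | var n => exact .var _
  | app _ _ ihM ihN => exact .app (ihM _) (ihN _)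
  | ofNeutral _ ih => exact .ofNeutral (ih _)
  | lam _ ih => exact .lam (ih _)
  | pair _ _ ihM ihN => exact .pair (ihM _) (ihN _)

theorem Nf.not_hasCopy {b : Bool} {M : Tm} (h : Nf b M) : ¬ M.HasCopy := by
  induction h <;> simp_all [Tm.HasCopy]

theorem Nf.not_hasProj {b : Bool} {M : Tm} (h : Nf b M) : ¬ M.HasProj := by
  induction h <;> simp_all [Tm.HasProj]

theorem Nf.valueGrammar {b : Bool} {M : Tm} (h : Nf b M) : ValueGrammar M := by
  induction h with
  | var n => exact .var n
  | app _ _ ihM ihN => exact .app ihM ihN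
  | ofNeutral _ ih => exact ih
  | lam _ ih => exact .lam ih
  | pair _ _ ihM ihN => exact .pair ihM ihN

/-- The head variable is free. This excludes neutral terms from pair types without names. -/
theorem Nf.FV_nonempty {M : Tm} (h : Nf true M) : M.FV.Nonempty := by
  generalize hb : true = b at h
  induction h with
  | var n => exact ⟨n, rfl⟩
  | app _ _ ih _ => exact (ih rfl).mono Set.subset_union_left
  | _ => cases hb

theorem Compat.step {M N : Tm} (h : Compat BetaRule M N) : Step M N := by
  induction h with
  | root h => cases h with | beta M N => exact .root (.beta M N)
  | lam _ ih => exact .lam ih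
  | app_left _ ih => exact .app_left ih
  | app_right _ ih => exact .app_right ih
  | pair_left _ ih => exact .pair_left ih
  | pair_right _ ih => exact .pair_right ih
  | proj _ ih => exact .proj ih
  | copy_sup _ ih => exact .copy_sup ih
  | copy_arg _ ih => exact .copy_arg ih
  | copy_left _ ih => exact .copy_left ih
  | copy_right _ ih => exact .copy_right ih

theorem Nf.mem_values {b : Bool} {M : Tm} (h : Nf b M) (hM : M.FV = ∅) : M ∈ Values :=
  ⟨h.valueGrammar, hM, fun _ hN => h.isNormal _ hN.step⟩

/-- The terms convertible to a neutral normal form (`b = true`) or to a normal form (`b = false`)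
without `copy` and projections whose free variables belong to `S`. -/
def HasNf (b : Bool) (S : Set ℕ) : Set Tm := {M | ∃ N, Conv M N ∧ Nf b N ∧ N.FV ⊆ S}

theorem HasNf.of_neutral {S : Set ℕ} {M : Tm} (h : M ∈ HasNf true S) : M ∈ HasNf false S := by
  obtain ⟨N, a, b, c⟩ := h
  exact ⟨N, a, b.ofNeutral, c⟩

theorem HasNf.mono {b : Bool} {S T : Set ℕ} (h : S ⊆ T) : HasNf b S ⊆ HasNf b T :=
  fun _ ⟨N, a, b, c⟩ => ⟨N, a, b, c.trans h⟩

theorem HasNf.var {S : Set ℕ} {x : ℕ} (h : x ∈ S) : Tm.var x ∈ HasNf true S :=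
  ⟨_, Steps.conv .refl, .var x, by simpa [Tm.FV] using h⟩

theorem HasNf.app {S : Set ℕ} {M N : Tm} (hM : M ∈ HasNf true S) (hN : N ∈ HasNf false S) :
    Tm.app M N ∈ HasNf true S := by
  obtain ⟨M', a, b, c⟩ := hM
  obtain ⟨N', d, e, f⟩ := hN
  exact ⟨_, a.app d, b.app e, Set.union_subset c f⟩

theorem HasNf.pair {S : Set ℕ} {M N : Tm} (hM : M ∈ HasNf false S) (hN : N ∈ HasNf false S) :
    Tm.pair M N ∈ HasNf false S := by
  obtain ⟨M', a, b, c⟩ := hM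
  obtain ⟨N', d, e, f⟩ := hN
  exact ⟨_, a.pair d, b.pair e, Set.union_subset c f⟩

theorem Steps.app_var_cases {M R : Tm} {x : ℕ} (h : Steps (.app M (.var x)) R) :
    (∃ M', Steps M M' ∧ R = .app M' (.var x)) ∨
      ∃ P, Steps M (.lam P) ∧ Steps (P.inst (.var x)) R := by
  induction h with
  | refl => exact Or.inl ⟨M, .refl, rfl⟩
  | tail _ h ih =>
    rcases ih with ⟨M', hM, rfl⟩ | ⟨P, hP, hR⟩
    · cases h with
      | root h =>
        cases h with
        | beta P => exact Or.inr ⟨P, hM, .refl⟩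
      | app_left h => exact Or.inl ⟨_, hM.tail h, rfl⟩
      | app_right h => exact ((Nf.var x).isNormal _ h).elim
    · exact Or.inr ⟨P, hP, hR.tail h⟩

theorem Steps.rename {M N : Tm} (h : Steps M N) (ρ : ℕ → ℕ) : Steps (M.rename ρ) (N.rename ρ) := by
  rw [steps_eq_reflTransGen_par] at h ⊢
  induction h with
  | refl => exact .refl
  | tail _ h ih => exact ih.tail (h.rename ρ)

/-- Applying to a fresh variable reflects normalizability. Either the normal form is still an
application `M' x`, with `M'` neutral, or `M` reduces to an abstraction whose body is a renaming
away from a normalizing term. -/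
theorem HasNf.of_app_var {S : Set ℕ} {M : Tm} {x : ℕ} (hx : x ∉ M.FV)
    (h : Tm.app M (.var x) ∈ HasNf false S) : M ∈ HasNf false S := by
  obtain ⟨Q, hQ, nQ, fQ⟩ := h
  rcases (hQ.steps nQ.isNormal).app_var_cases with ⟨M', hM, rfl⟩ | ⟨P, hP, hR⟩
  · cases nQ with
    | ofNeutral h =>
      cases h with
      | app h _ => exact ⟨M', hM.conv, h.ofNeutral, Set.subset_union_left.trans fQ⟩
  -- `θ` undoes the instantiation of the bound variable by `x`: it sends `x` back to index `0` and
  -- shifts the rest. It is an inverse on `P` because `x` is not free in `M`, hence not in `.lam P`.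
  · let θ : ℕ → ℕ := fun n => if n = x then 0 else n + 1
    have e : (P.inst (.var x)).rename θ = P := by
      rw [Tm.inst, Tm.rename_subst]
      refine (P.subst_congr fun n hn => ?_).trans P.subst_var
      cases n with
      | zero => simp [Tm.single, Tm.rename, θ]
      | succ n =>
        have hne : n ≠ x := fun h => hx (hP.FV_subset (h ▸ hn))
        simp [Tm.single, Tm.rename, θ, hne]
    have h := hR.rename θ
    rw [e] at h
    refine ⟨.lam (Q.rename θ), Steps.conv (hP.trans h.lam), (nQ.rename θ).lam, fun n hn => ?_⟩
    obtain ⟨m, hm, hmn⟩ := Tm.exists_of_mem_FV_rename hn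
    by_cases hmx : m = x
    · simp [θ, hmx] at hmn
    · obtain rfl : m = n := by simpa [θ, hmx] using hmn
      exact fQ hm

/-! ## The interpretation of types -/

/-- Sets of terms closed under conversion, together with the set of variables that may occur in the
neutral elements of pair types. -/
structure Cand : Type where
  carrier : Set Tm
  names : Set ℕ
  conv : ∀ {M N : Tm}, Conv M N → M ∈ carrier → N ∈ carrier

/-- The valuation that sends `0` to `X` and `n + 1` to `v n`. -/
def Cand.cons (X : Cand) (v : ℕ → Cand) : ℕ → Cand
  | 0 => X
  | n + 1 => v n

/-- The candidate of all terms, without names. -/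
def Cand.top : Cand := ⟨Set.univ, ∅, fun _ _ => trivial⟩

/-- The candidate of functions from `X` to `Y`. -/
def Cand.arrow (X Y : Cand) : Cand where
  carrier := {M | ∀ N ∈ X.carrier, Tm.app M N ∈ Y.carrier}
  names := X.names ∪ Y.names
  conv h hM N hN := Y.conv (h.app (Steps.conv .refl)) (hM N hN)

/-- The candidate of pairs, and of neutral terms whose free variables are names. -/
def Cand.prod (X Y : Cand) : Cand where
  carrier := {M | (∃ P ∈ X.carrier, ∃ Q ∈ Y.carrier, Conv M (.pair P Q)) ∨
    M ∈ HasNf true (X.names ∪ Y.names)}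
  names := X.names ∪ Y.names
  conv := by
    rintro M N h (⟨P, hP, Q, hQ, e⟩ | ⟨Q, e, hQ⟩)
    · exact Or.inl ⟨P, hP, Q, hQ, h.symm.trans e⟩
    · exact Or.inr ⟨Q, h.symm.trans e, hQ⟩

/-- The intersection of a family of candidates indexed by all candidates. -/
def Cand.inter (F : Cand → Cand) : Cand where
  carrier := {M | ∀ X, M ∈ (F X).carrier}
  names := (F Cand.top).names
  conv h hM X := (F X).conv h (hM X)

/-- The interpretation of a type under a valuation of its free variables. -/
def Ty.interp : Ty → (ℕ → Cand) → Cand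
  | .var n, v => v n
  | .lolli A B, v => (A.interp v).arrow (B.interp v)
  | .with_ A B, v => (A.interp v).prod (B.interp v)
  | .all A, v => Cand.inter fun X => A.interp (X.cons v)

theorem Ty.interp_rename (A : Ty) (ρ : ℕ → ℕ) (v : ℕ → Cand) :
    (A.rename ρ).interp v = A.interp (v ∘ ρ) := by
  induction A generalizing ρ v with
  | var n => rfl
  | lolli A B ihA ihB => simp only [Ty.rename, Ty.interp, ihA, ihB]
  | with_ A B ihA ihB => simp only [Ty.rename, Ty.interp, ihA, ihB]
  | all A ih =>
    simp only [Ty.rename, Ty.interp, ih]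
    congr! 3 with X
    funext n
    cases n <;> rfl

theorem Ty.interp_subst (A : Ty) (τ : ℕ → Ty) (v : ℕ → Cand) :
    (A.subst τ).interp v = A.interp fun n => (τ n).interp v := by
  induction A generalizing τ v with
  | var n => rfl
  | lolli A B ihA ihB => simp only [Ty.subst, Ty.interp, ihA, ihB]
  | with_ A B ihA ihB => simp only [Ty.subst, Ty.interp, ihA, ihB]
  | all A ih =>
    simp only [Ty.subst, Ty.interp, ih]
    congr! 3 with X
    funext n
    cases n with
    | zero => rfl
    | succ n => exact Ty.interp_rename _ _ _

theorem Ty.interp_inst (A B : Ty) (v : ℕ → Cand) :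
    (A.inst B).interp v = A.interp ((B.interp v).cons v) := by
  rw [Ty.inst, Ty.interp_subst]
  congr 1
  funext n
  cases n <;> rfl

theorem Ty.interp_congr (A : Ty) {v w : ℕ → Cand} (h : ∀ n ∈ A.FV, v n = w n) :
    A.interp v = A.interp w := by
  induction A generalizing v w with
  | var n => exact h n rfl
  | lolli A B ihA ihB =>
    simp only [Ty.interp, ihA fun n hn => h n (Or.inl hn), ihB fun n hn => h n (Or.inr hn)]
  | with_ A B ihA ihB =>
    simp only [Ty.interp, ihA fun n hn => h n (Or.inl hn), ihB fun n hn => h n (Or.inr hn)]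
  | all A ih =>
    simp only [Ty.interp]
    congr 1
    funext X
    refine ih fun n hn => ?_
    cases n with
    | zero => rfl
    | succ n => exact h n hn

theorem Ty.names_interp_subset (A : Ty) {S : Set ℕ} {v : ℕ → Cand} (h : ∀ n, (v n).names ⊆ S) :
    (A.interp v).names ⊆ S := by
  induction A generalizing v with
  | var n => exact h n
  | lolli A B ihA ihB => exact Set.union_subset (ihA h) (ihB h)
  | with_ A B ihA ihB => exact Set.union_subset (ihA h) (ihB h)
  | all A ih =>
    refine ih fun n => ?_
    cases n with
    -- The names of a quantified type are computed at `Cand.top`, so a bound variable contributes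
    -- none.
    | zero => exact Set.empty_subset S
    | succ n => exact h n

theorem Ty.Closed.interp_eq {A : Ty} (hA : A.Closed) (v w : ℕ → Cand) :
    A.interp v = A.interp w :=
  A.interp_congr fun n hn => by rw [hA] at hn; exact hn.elim

/-- The valuation is immaterial for a closed type, so it may be taken constantly `Cand.top`, where
there are no names at all. -/
theorem Ty.Closed.names_interp {A : Ty} (hA : A.Closed) (v : ℕ → Cand) :
    (A.interp v).names = ∅ := by
  rw [hA.interp_eq v fun _ => Cand.top]
  exact Set.subset_empty_iff.1 (A.names_interp_subset fun _ => subset_rfl)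

/-! ## Lazy types -/

/-- `Polar true A`: no negative subtype of `A` is a quantification; `Polar false A`: no positive
subtype of `A` is a quantification. -/
def Ty.Polar : Bool → Ty → Prop
  | _, .var _ => True
  | p, .lolli A B => A.Polar (!p) ∧ B.Polar p
  | p, .with_ A B => A.Polar p ∧ B.Polar p
  | p, .all A => p = true ∧ A.Polar p

theorem Ty.ForallLazy.polar_of_isSubtype {A B : Ty} (hA : A.ForallLazy) {p : Bool}
    (h : IsSubtype A p B) : B.Polar p := by
  induction B generalizing p with
  | var n => trivial
  | lolli B C ihB ihC => exact ⟨ihB h.lolli_left, ihC h.lolli_right⟩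
  | with_ B C ihB ihC => exact ⟨ihB h.with_left, ihC h.with_right⟩
  | all B ih =>
    refine ⟨?_, ih h.all⟩
    cases p with
    | false => exact (hA ⟨B, h⟩).elim
    | true => rfl

theorem Ty.ForallLazy.polar {A : Ty} (hA : A.ForallLazy) : A.Polar true :=
  hA.polar_of_isSubtype .refl

/-- Without positive ∀, the path through right-hand components ends in a free type variable, whose
names already contain `S`. This is how neutral terms enter negative pair types. -/
theorem Ty.Polar.subset_names_interp {A : Ty} (hA : A.Polar false) {S : Set ℕ} {v : ℕ → Cand}
    (h : ∀ n, S ⊆ (v n).names) : S ⊆ (A.interp v).names := by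
  induction A with
  | var n => exact h n
  | lolli A B _ ihB => exact (ihB hA.2).trans Set.subset_union_right
  | with_ A B _ ihB => exact (ihB hA.2).trans Set.subset_union_right
  | all A _ => exact absurd hA.1 Bool.false_ne_true

/-- A valuation is standard for `S` if its values lie between the neutral and the normalizing terms
with free variables in `S`. -/
def IsStandard (S : Set ℕ) (v : ℕ → Cand) : Prop :=
  ∀ n, (v n).names = S ∧ HasNf true S ⊆ (v n).carrier ∧ (v n).carrier ⊆ HasNf false S

/-- The candidate of the normalizing terms with free variables in `S`. -/
def Cand.normalizing (S : Set ℕ) : Cand :=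
  ⟨HasNf false S, S, fun h ⟨Q, e, hQ⟩ => ⟨Q, h.symm.trans e, hQ⟩⟩

theorem isStandard_normalizing (S : Set ℕ) : IsStandard S fun _ => Cand.normalizing S :=
  fun _ => ⟨rfl, fun _ => HasNf.of_neutral, subset_rfl⟩

theorem IsStandard.cons {S : Set ℕ} {v : ℕ → Cand} (hv : IsStandard S v) :
    IsStandard S ((Cand.normalizing S).cons v) := by
  rintro (_ | n)
  · exact ⟨rfl, fun _ => HasNf.of_neutral, subset_rfl⟩
  · exact hv n

/-- The two inclusions need each other because ⊸ flips polarity on its left. Infinity of `S`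
supplies fresh variables to which functions are applied. -/
theorem IsStandard.interp {S : Set ℕ} (hS : S.Infinite) (A : Ty) {v : ℕ → Cand}
    (hv : IsStandard S v) :
    (A.Polar true → (A.interp v).carrier ⊆ HasNf false S) ∧
      (A.Polar false → HasNf true S ⊆ (A.interp v).carrier) := by
  induction A generalizing v with
  | var n => exact ⟨fun _ => (hv n).2.2, fun _ => (hv n).2.1⟩
  | lolli A B ihA ihB =>
    refine ⟨fun h M hM => ?_, fun h M hM N hN =>
      (ihB hv).2 h.2 (HasNf.app hM ((ihA hv).1 h.1 hN))⟩
    obtain ⟨x, hx, hxM⟩ := hS.exists_notMem_finite M.FV_finite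
    exact HasNf.of_app_var hxM ((ihB hv).1 h.2 (hM _ ((ihA hv).2 h.1 (HasNf.var hx))))
  | with_ A B ihA ihB =>
    constructor
    · rintro h M (⟨P, hP, Q, hQ, e⟩ | hM)
      · exact (Cand.normalizing S).conv e.symm
          (HasNf.pair ((ihA hv).1 h.1 hP) ((ihB hv).1 h.2 hQ))
      · have hs : ∀ C : Ty, (C.interp v).names ⊆ S :=
          fun C => C.names_interp_subset fun n => (hv n).1.le
        exact HasNf.of_neutral (HasNf.mono (Set.union_subset (hs A) (hs B)) hM)
    · exact fun h M hM => Or.inr (HasNf.mono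
        ((h.1.subset_names_interp fun n => (hv n).1.ge).trans Set.subset_union_left) hM)
  | all A ih =>
    -- A positive ∀ is tested at the single candidate `Cand.normalizing S`, which keeps the
    -- valuation standard; a negative ∀ cannot occur.
    exact ⟨fun h M hM => (ih hv.cons).1 h.2 (hM _), fun h => absurd h.1 Bool.false_ne_true⟩

theorem exists_value_of_forall_infinite {M : Tm}
    (h : ∀ S : Set ℕ, S.Infinite → M ∈ HasNf false S) : ∃ U ∈ Values, IsNormalFormOf U M := by
  -- With `S` the complement of the free variables of `M`, the normal form has variables only
  -- outside `M`; reduction creates none, so it is closed.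
  obtain ⟨U, a, b, c⟩ := h _ M.FV_finite.infinite_compl
  have s := a.steps b.isNormal
  refine ⟨U, b.mem_values (Set.eq_empty_of_forall_notMem fun n hn => c hn (s.FV_subset hn)),
    s, b.isNormal⟩

/-- The interpretation does not depend on the valuation, so the standard valuation for each infinite
`S` may be used in turn. -/
theorem Ty.Closed.exists_value {A : Ty} (hA : A.Closed) (hl : A.ForallLazy) {v : ℕ → Cand} {M : Tm}
    (hM : M ∈ (A.interp v).carrier) : ∃ U ∈ Values, IsNormalFormOf U M :=
  exists_value_of_forall_infinite fun S hS =>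
    (IsStandard.interp hS A (isStandard_normalizing S)).1 hl.polar (hA.interp_eq v _ ▸ hM)

/-! ## Adequacy -/

/-- The substitution `σ` realizes the context `Γ` under the valuation `v`. -/
def Realizes (v : ℕ → Cand) (σ : ℕ → Tm) (Γ : Ctx) : Prop :=
  ∀ p ∈ Γ, σ p.1 ∈ (p.2.interp v).carrier

theorem Realizes.update {v : ℕ → Cand} {σ : ℕ → Tm} {Γ : Ctx} (h : Realizes v σ Γ) {x : ℕ} {A : Ty}
    {N : Tm} (hx : x ∉ Γ.dom) (hN : N ∈ (A.interp v).carrier) :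
    Realizes v (Function.update σ x N) ((x, A) ::ₘ Γ) := by
  intro p hp
  rcases Multiset.mem_cons.1 hp with rfl | hp
  · simpa using hN
  · have hne : p.1 ≠ x := fun e => hx ⟨p.2, e ▸ hp⟩
    simpa [hne] using h p hp

theorem Realizes.cons {v : ℕ → Cand} {σ : ℕ → Tm} {Γ : Ctx} (h : Realizes v σ Γ) {A : Ty}
    {N : Tm} (hN : N ∈ (A.interp v).carrier) :
    Realizes v (Tm.cons N σ) ((0, A) ::ₘ Γ.shiftVar) := by
  intro p hp
  rcases Multiset.mem_cons.1 hp with rfl | hp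
  · exact hN
  · obtain ⟨q, hq, rfl⟩ := Multiset.mem_map.1 hp
    exact h q hq

theorem Realizes.shiftTy {v : ℕ → Cand} {σ : ℕ → Tm} {Γ : Ctx} (h : Realizes v σ Γ) (X : Cand) :
    Realizes (X.cons v) σ Γ.shiftTy := by
  intro p hp
  obtain ⟨q, hq, rfl⟩ := Multiset.mem_map.1 hp
  rw [Ty.interp_rename]
  exact h q hq

theorem Realizes.left {v : ℕ → Cand} {σ : ℕ → Tm} {Γ Δ : Ctx} (h : Realizes v σ (Γ + Δ)) :
    Realizes v σ Γ := fun p hp => h p (Multiset.mem_add.2 (Or.inl hp))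

theorem Realizes.right {v : ℕ → Cand} {σ : ℕ → Tm} {Γ Δ : Ctx} (h : Realizes v σ (Γ + Δ)) :
    Realizes v σ Δ := fun p hp => h p (Multiset.mem_add.2 (Or.inr hp))

theorem Realizes.tail {v : ℕ → Cand} {σ : ℕ → Tm} {Γ : Ctx} {p : ℕ × Ty}
    (h : Realizes v σ (p ::ₘ Γ)) : Realizes v σ Γ := fun q hq => h q (Multiset.mem_cons_of_mem hq)

/-- Without names the neutral alternative would be a neutral normal form with no free variable,
which does not exist. -/
theorem Cand.exists_pair_of_mem_prod {X Y : Cand} (hX : X.names = ∅) (hY : Y.names = ∅) {M : Tm}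
    (h : M ∈ (X.prod Y).carrier) :
    ∃ P ∈ X.carrier, ∃ Q ∈ Y.carrier, Conv M (.pair P Q) := by
  rcases h with h | ⟨N, _, hN, hS⟩
  · exact h
  · obtain ⟨n, hn⟩ := hN.FV_nonempty
    simpa [hX, hY] using hS hn

theorem Conv.proj {i : Fin 2} {M M' : Tm} (h : Conv M M') : Conv (.proj i M) (.proj i M') := by
  obtain ⟨R, a, b⟩ := h
  exact ⟨_, a.proj, b.proj⟩

theorem Derives.adequate {Γ : Ctx} {M : Tm} {A : Ty} (h : Derives Γ M A) {v : ℕ → Cand}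
    {σ : ℕ → Tm} (hσ : Realizes v σ Γ) : M.subst σ ∈ (A.interp v).carrier := by
  induction h generalizing v σ with
  | ax x A => exact hσ (x, A) (Multiset.mem_singleton_self _)
  | cut _ _ hx _ ihN ihM =>
    rw [Tm.substVar_subst]
    exact ihM (hσ.right.update hx (ihN hσ.left))
  | @lolliR Γ M A B _ ih =>
    intro N hN
    refine (B.interp v).conv ?_ (ih (hσ.cons hN))
    rw [← Tm.inst_subst_liftSub]
    -- Closure of candidates under conversion absorbs this β-step.
    exact (Steps.conv (.single (.root (.beta _ _)))).symm
  | lolliL _ _ hx _ _ _ _ ihN ihM =>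
    rw [Tm.substVar_subst]
    refine ihM (hσ.tail.right.update hx ?_)
    exact hσ (_, _) (Multiset.mem_cons_self _ _) _ (ihN hσ.tail.left)
  | allR _ _ ih => exact fun X => ih (hσ.shiftTy X)
  | @allL Γ x M A B C _ ih =>
    refine ih fun p hp => ?_
    rcases Multiset.mem_cons.1 hp with rfl | hp
    · rw [Ty.interp_inst]
      -- The intersection is instantiated at the interpretation of `B`.
      exact hσ (x, .all A) (Multiset.mem_cons_self _ _) _
    · exact hσ.tail p hp
  | withR0 _ _ _ _ _ _ ih₁ ih₂ =>
    exact Or.inl ⟨_, ih₁ hσ, _, ih₂ hσ, Steps.conv .refl⟩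
  | @withL1 Γ x y M A₁ A₂ C _ hx _ h₁ _ h₂ _ ih =>
    rw [Tm.substVar_subst]
    obtain ⟨P, hP, Q, hQ, e⟩ := Cand.exists_pair_of_mem_prod (h₁.names_interp v)
      (h₂.names_interp v) (hσ (y, .with_ A₁ A₂) (Multiset.mem_cons_self _ _))
    exact ih (hσ.tail.update hx ((A₁.interp v).conv
      (e.proj.trans (Steps.conv (.single (.root (.proj_fst P Q))))).symm hP))
  | @withL2 Γ x y M A₁ A₂ C _ hx _ h₁ _ h₂ _ ih =>
    rw [Tm.substVar_subst]
    obtain ⟨P, hP, Q, hQ, e⟩ := Cand.exists_pair_of_mem_prod (h₁.names_interp v)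
      (h₂.names_interp v) (hσ (y, .with_ A₁ A₂) (Multiset.mem_cons_self _ _))
    exact ih (hσ.tail.update hx ((A₂.interp v).conv
      (e.proj.trans (Steps.conv (.single (.root (.proj_snd P Q))))).symm hQ))
  | @withR1 x M₁ M₂ V A A₁ A₂ _ _ _ hV hA hl _ _ _ _ ih₁ ih₂ _ =>
    have hN := hσ (x, A) (Multiset.mem_singleton_self _)
    -- The argument has a closed lazy type, so it reduces to a value `U`; realizing both premises
    -- with `U` matches exactly what the `copy` step produces.
    obtain ⟨U, hU, hs, -⟩ := hA.exists_value hl hN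
    have hr : Realizes v (Tm.cons U σ) {(0, A)} := by
      intro p hp
      obtain rfl := Multiset.mem_singleton.1 hp
      exact (A.interp v).conv (Steps.conv hs) hN
    refine Or.inl ⟨_, ih₁ hr, _, ih₂ hr, Steps.conv ?_⟩
    simp only [Tm.subst, Tm.subst_of_closed hV.2.1]
    rw [← Tm.inst_subst_liftSub, ← Tm.inst_subst_liftSub]
    exact (Steps.copy .refl hs .refl .refl).tail (.root (.copy _ _ _ _ hV hU))

/-! ### Normalization of lazy judgements -/

theorem polar_of_foldr {l : List (ℕ × Ty)} {B : Ty}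
    (h : (l.foldr (fun p C => Ty.lolli p.2 C) B).Polar true) :
    (∀ p ∈ l, p.2.Polar false) ∧ B.Polar true := by
  induction l with
  | nil => exact ⟨by simp, h⟩
  | cons p l ih =>
    have := ih h.2
    exact ⟨List.forall_mem_cons.2 ⟨h.1, this.1⟩, this.2⟩

/-- Adequacy at the identity substitution: laziness gives each assumption a type without positive ∀,
which contains its own variable, and a conclusion whose elements normalize. -/
theorem Derives.hasNf {Γ : Ctx} {M : Tm} {A : Ty} (hD : Derives Γ M A)
    (hlazy : ForallLazyJudgement Γ A) {S : Set ℕ} (hS : S.Infinite) (hΓ : Γ.dom ⊆ S) :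
    M ∈ HasNf false S := by
  obtain ⟨l, rfl, hl⟩ := hlazy
  obtain ⟨h₁, h₂⟩ := polar_of_foldr hl.polar
  have hv := isStandard_normalizing S
  have := hD.adequate (σ := Tm.var) (v := fun _ => Cand.normalizing S) fun p hp =>
    (hv.interp hS p.2).2 (h₁ p hp) (HasNf.var (hΓ ⟨p.2, hp⟩))
  rw [Tm.subst_var] at this
  exact (hv.interp hS A).1 h₂ this

theorem IsNormalFormOf.eq {M N N' : Tm} (h : IsNormalFormOf N M) (h' : IsNormalFormOf N' M) :
    N = N' :=
  h.2.eq_of_steps ((h.1.conv.symm.trans h'.1.conv).steps h'.2)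

end LAM

theorem mainTheorem6 (Γ : LAM.Ctx) (M : LAM.Tm) (A : LAM.Ty)
    (hD : LAM.Derives Γ M A) (hlazy : LAM.ForallLazyJudgement Γ A) :
    (∃! N : LAM.Tm, LAM.IsNormalFormOf N M) ∧
      ∀ N : LAM.Tm, LAM.IsNormalFormOf N M →
        (¬ N.HasCopy ∧ ¬ N.HasProj) ∧ (Γ = 0 → N ∈ LAM.Values) := by
  -- Existence needs no control of free variables, so `S` is everything; for the empty context
  -- below, every infinite `S` is allowed, which forces the normal form to be closed.
  obtain ⟨N, a, b, -⟩ := hD.hasNf hlazy Set.infinite_univ (Set.subset_univ _)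
  have hN : LAM.IsNormalFormOf N M := ⟨a.steps b.isNormal, b.isNormal⟩
  refine ⟨⟨N, hN, fun N' h => h.eq hN⟩, fun N' h => ?_⟩
  obtain rfl := h.eq hN
  refine ⟨⟨b.not_hasCopy, b.not_hasProj⟩, ?_⟩
  rintro rfl
  obtain ⟨U, hU, hs⟩ := LAM.exists_value_of_forall_infinite fun S hS =>
    hD.hasNf hlazy hS (by rintro x ⟨B, hB⟩; exact absurd hB (Multiset.notMem_zero _))
  exact hN.eq hs ▸ hU
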